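/- For $u>0$ let $\zeta(s,u)$ denote the Hurwitz zeta function, i.e. the analytic continuation to $s\in\mathbb{C}\setminus\{1\}$ of $\sum_{k\ge 0}(k+u)^{-s}$ ($\operatorname{Re}s>1$), let $\zeta(s)$ be the Riemann zeta function, let primes denote derivatives with respect to $s$, and let $\psi(x)=\frac{d}{dx}\log\Gamma(x)$ for $x>0$. Then for every real $u>0$ $$\zeta''(0,u)=\left(\tfrac12-u\right)\log^2u+2u\log u-2u+2\int_0^\infty\left[\psi(t+u)-\log(t+u)+\frac{1}{2(t+u)}\right]\log t\,dt ,$$ where the integral converges absolutely. In particular, for $u=1$, $$\zeta''(0)=-2+2\int_0^\infty\left[\psi(t+1)-\log(t+1)+\frac{1}{2(t+1)}\right]\log t\,dt ,$$ and this agrees with the formula $$\zeta''(0)=2\int_0^\infty\left[\psi(1+t)-\log t-\frac{1}{2(1+t)}\right]\log t\,dt ;$$ that is, the last integral also converges absolutely, the right-hand sides of the last two formulas are equal, and both formulas hold. -/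

import Mathlib

/-- The real digamma function `ψ`, the logarithmic derivative of the Gamma function. -/
noncomputable def realDigamma : ℝ → ℝ := logDeriv Real.Gamma

/-- The Hurwitz zeta function `ζ(s, u)` for a real parameter `u > 0`, i.e. the analytic continuation
in `s` of `∑_{k ≥ 0} (k + u) ^ (-s)`. Mathlib's `HurwitzZeta.hurwitzZeta` is periodic in `u` and
has this meaning for `0 < u ≤ 1` only. For general `u > 0`, put `m = ⌈u⌉ - 1`, so that
`u - m ∈ (0, 1]`, and remove the first `m` terms of the series with parameter `u - m`.
See `hasSum_hurwitzZetaPos` and `differentiableAt_hurwitzZetaPos`. -/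
noncomputable def hurwitzZetaPos (u : ℝ) (s : ℂ) : ℂ :=
  HurwitzZeta.hurwitzZeta (u : UnitAddCircle) s -
    ∑ k ∈ Finset.range (⌈u⌉₊ - 1), 1 / ((k : ℂ) + ((u - ((⌈u⌉₊ - 1 : ℕ) : ℝ) : ℝ) : ℂ)) ^ s

/-- For `Re s > 1`, `ζ(s, u) = ∑_{k ≥ 0} (k + u) ^ (-s)`. -/
theorem hasSum_hurwitzZetaPos {u : ℝ} (hu : 0 < u) {s : ℂ} (hs : 1 < s.re) :
    HasSum (fun k : ℕ => 1 / ((k : ℂ) + (u : ℂ)) ^ s) (hurwitzZetaPos u s) := by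
  have hc : 1 ≤ ⌈u⌉₊ := Nat.one_le_iff_ne_zero.mpr (Nat.ceil_pos.mpr hu).ne'
  have hlt : (⌈u⌉₊ : ℝ) < u + 1 := Nat.ceil_lt_add_one hu.le
  have hle : u ≤ ⌈u⌉₊ := Nat.le_ceil u
  unfold hurwitzZetaPos
  set m : ℕ := ⌈u⌉₊ - 1 with hm
  have hmc : (m : ℝ) = ⌈u⌉₊ - 1 := by rw [hm]; push_cast [hc]; ring
  have hcoe : ((u - (m : ℝ) : ℝ) : UnitAddCircle) = (u : UnitAddCircle) := by
    rw [AddCircle.coe_sub]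
    have : ((m : ℝ) : UnitAddCircle) = 0 := by
      rw [AddCircle.coe_eq_zero_iff]
      exact ⟨m, by simp⟩
    rw [this, sub_zero]
  have h := HurwitzZeta.hasSum_hurwitzZeta_of_one_lt_re (a := u - (m : ℝ))
    ⟨by linarith, by linarith⟩ hs
  rw [hcoe, ← hasSum_nat_add_iff' m] at h
  refine h.congr_fun ?_
  intro k
  push_cast
  congr 2
  ring

/-- `s ↦ ζ(s, u)` is holomorphic on `ℂ \ {1}`. -/
theorem differentiableAt_hurwitzZetaPos {u : ℝ} (hu : 0 < u) {s : ℂ} (hs : s ≠ 1) :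
    DifferentiableAt ℂ (hurwitzZetaPos u) s := by
  have hlt : (⌈u⌉₊ : ℝ) < u + 1 := Nat.ceil_lt_add_one hu.le
  have hc : 1 ≤ ⌈u⌉₊ := Nat.one_le_iff_ne_zero.mpr (Nat.ceil_pos.mpr hu).ne'
  have hmc : ((⌈u⌉₊ - 1 : ℕ) : ℝ) = ⌈u⌉₊ - 1 := by push_cast [hc]; ring
  unfold hurwitzZetaPos
  refine (HurwitzZeta.differentiableAt_hurwitzZeta _ hs).sub
    (DifferentiableAt.fun_sum fun k _ => ?_)
  have hpos : (0 : ℝ) < (k : ℝ) + (u - ((⌈u⌉₊ - 1 : ℕ) : ℝ)) := by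
    have : (0 : ℝ) ≤ k := k.cast_nonneg
    linarith
  have hne : ((k : ℂ) + ((u - ((⌈u⌉₊ - 1 : ℕ) : ℝ) : ℝ) : ℂ)) ≠ 0 := by
    exact_mod_cast hpos.ne'
  refine (differentiableAt_const _).div (differentiableAt_id.const_cpow (Or.inl hne)) ?_
  exact fun h => hne ((Complex.cpow_eq_zero_iff _ _).mp h).1

/-! Both sides are reduced to one integral against the weight w(y) = {y}(1 - {y}), the Peano kernel
of the trapezoidal rule: two integrations by parts turn ∫ w(y - a) g''(y) dy into the gap between a
sum of values of g and its integral (`tendsto_sum_sub_integral`).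

For g(y) = y^(-s) this continues ζ(s, u) to Re s > -1 as u^(-s)/2 + u^(1-s)/(s-1) + s(s+1)/2 · W(s),
where W(s) = ∫_u^∞ w(y-u) y^(-s-2) dy. Differentiating twice at 0 gives the elementary terms plus
W(0) + W'(0) = ∫_u^∞ w(y-u)(1 - log y)/y² dy.

For g(y) = 1/(t+y) it gives ψ(t+u) - log(t+u) + 1/(2(t+u)) = -∫_u^∞ w(y-u)/(t+y)³ dy. Multiplying by
log t, applying Fubini and using ∫_0^∞ log t/(t+y)³ dt = (log y - 1)/(2y²) yields the same integral
(`integral_realDigamma_mul_log`).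

At u = 1 the two integrands differ by (log(1+t) - log t - 1/(1+t)) log t, whose integral is -1 by an
explicit antiderivative. -/

open Filter Topology MeasureTheory Set

/-! ### Trapezoidal rule with integral remainder -/

/-- The `1`-periodic function `y ↦ {y} (1 - {y})`, the weight in the error term of the
trapezoidal rule. -/
noncomputable def trapezoidWeight (y : ℝ) : ℝ := Int.fract y * (1 - Int.fract y)

theorem measurable_trapezoidWeight : Measurable trapezoidWeight :=
  measurable_fract.mul (measurable_const.sub measurable_fract)

theorem trapezoidWeight_nonneg (y : ℝ) : 0 ≤ trapezoidWeight y :=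
  mul_nonneg (Int.fract_nonneg y) (by linarith [Int.fract_lt_one y])

theorem trapezoidWeight_le_one (y : ℝ) : trapezoidWeight y ≤ 1 := by
  unfold trapezoidWeight
  nlinarith [Int.fract_nonneg y, Int.fract_lt_one y]

/-- The right endpoint is allowed because the weight vanishes at integers, as the polynomial does at
both ends. -/
theorem trapezoidWeight_eq {n : ℕ} {y : ℝ} (h₁ : (n : ℝ) ≤ y) (h₂ : y ≤ n + 1) :
    trapezoidWeight y = (y - n) * (1 - (y - n)) := by
  rcases h₂.eq_or_lt with rfl | h₂
  · have : Int.fract ((n : ℝ) + 1) = 0 := by simp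
    simp [trapezoidWeight, this]
  · have : Int.fract y = y - n := by
      rw [Int.fract_eq_iff]
      exact ⟨by linarith, by linarith, n, by simp⟩
    rw [trapezoidWeight, this]

section Trapezoid

variable {E : Type*} [NormedAddCommGroup E] [NormedSpace ℝ E] [CompleteSpace E]
  {g g' g'' : ℝ → E} {a : ℝ}

/-- With p(x) = x(1 - x), the function p g' - p' g has derivative p g'' + 2g, since p'' = -2. At the
endpoints p vanishes and p' = ±1, which leaves the two values of g. -/
theorem integral_trapezoidWeight_smul_unit (hg : ∀ y, a ≤ y → HasDerivAt g (g' y) y)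
    (hg' : ∀ y, a ≤ y → HasDerivAt g' (g'' y) y) (hg'' : ContinuousOn g'' (Ici a)) (n : ℕ) :
    IntervalIntegrable (fun y => trapezoidWeight (y - a) • g'' y) volume (a + n) (a + (n + 1)) ∧
    ∫ y in (a + n)..(a + (n + 1)), trapezoidWeight (y - a) • g'' y =
      g (a + n) + g (a + (n + 1)) - (2 : ℝ) • ∫ y in (a + n)..(a + (n + 1)), g y := by
  have hn : (0 : ℝ) ≤ n := n.cast_nonneg
  have hI : uIcc (a + n) (a + (n + 1)) = Icc (a + n) (a + (n + 1)) := uIcc_of_le (by linarith)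
  have hsub : uIcc (a + n) (a + (n + 1)) ⊆ Ici a := by
    rw [hI]; exact fun y hy => mem_Ici.mpr (by linarith [hy.1])
  have hw : EqOn (fun y => trapezoidWeight (y - a) • g'' y)
      (fun y => ((y - a - n) * (1 - (y - a - n))) • g'' y) (uIcc (a + n) (a + (n + 1))) := by
    intro y hy
    rw [hI] at hy
    simp only
    rw [trapezoidWeight_eq (n := n) (by linarith [hy.1]) (by linarith [hy.2])]
  have hc : ContinuousOn (fun y => ((y - a - n) * (1 - (y - a - n))) • g'' y)
      (uIcc (a + n) (a + (n + 1))) :=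
    (Continuous.continuousOn (by fun_prop)).smul (hg''.mono hsub)
  have hcg : ContinuousOn g (uIcc (a + n) (a + (n + 1))) :=
    fun y hy => (hg y (hsub hy)).continuousAt.continuousWithinAt
  have hint := hc.intervalIntegrable (μ := volume)
  have hint' : IntervalIntegrable (fun y => (2 : ℝ) • g y) volume (a + n) (a + (n + 1)) :=
    (hcg.const_smul (2 : ℝ)).intervalIntegrable
  refine ⟨(hc.congr hw).intervalIntegrable (μ := volume), ?_⟩
  rw [intervalIntegral.integral_congr hw, eq_sub_iff_add_eq, ← intervalIntegral.integral_smul,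
    ← intervalIntegral.integral_add hint hint']
  have hd : ∀ y ∈ uIcc (a + n) (a + (n + 1)), HasDerivAt
      (fun y => ((y - a - n) * (1 - (y - a - n))) • g' y - (1 - 2 * (y - a - n)) • g y)
      (((y - a - n) * (1 - (y - a - n))) • g'' y + (2 : ℝ) • g y) y := by
    intro y hy
    have h0 : HasDerivAt (fun y : ℝ => y - a - n) 1 y :=
      ((hasDerivAt_id y).sub_const a).sub_const (n : ℝ)
    have h1 : HasDerivAt (fun y : ℝ => (y - a - n) * (1 - (y - a - n)))
        (1 - 2 * (y - a - n)) y := by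
      refine (h0.mul (h0.const_sub 1)).congr_deriv (by ring)
    have h2 : HasDerivAt (fun y : ℝ => 1 - 2 * (y - a - n)) (-2) y := by
      refine ((h0.const_mul 2).const_sub 1).congr_deriv (by ring)
    refine ((h1.smul (hg' y (hsub hy))).sub (h2.smul (hg y (hsub hy)))).congr_deriv ?_
    module
  rw [intervalIntegral.integral_eq_sub_of_hasDerivAt hd (hint.add hint')]
  have e1 : a + ((n : ℝ) + 1) - a - n = 1 := by ring
  have e2 : a + (n : ℝ) - a - n = 0 := by ring
  rw [e1, e2]
  module

theorem integral_trapezoidWeight_smul (hg : ∀ y, a ≤ y → HasDerivAt g (g' y) y)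
    (hg' : ∀ y, a ≤ y → HasDerivAt g' (g'' y) y) (hg'' : ContinuousOn g'' (Ici a)) (N : ℕ) :
    ∫ y in a..(a + N), trapezoidWeight (y - a) • g'' y =
      (2 : ℝ) • (∑ k ∈ Finset.range N, g (a + k)) - g a + g (a + N)
        - (2 : ℝ) • ∫ y in a..(a + N), g y := by
  have key := integral_trapezoidWeight_smul_unit hg hg' hg''
  have h1 := intervalIntegral.sum_integral_adjacent_intervals (μ := volume)
    (f := fun y => trapezoidWeight (y - a) • g'' y) (a := fun n : ℕ => a + n) (n := N)
    (fun k _ => by simpa using (key k).1)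
  have hcg : ∀ k : ℕ, IntervalIntegrable g volume (a + k) (a + (k + 1 : ℕ)) := by
    intro k
    refine ContinuousOn.intervalIntegrable fun y hy => ?_
    rw [uIcc_of_le (by push_cast; linarith)] at hy
    exact (hg y (by linarith [hy.1, k.cast_nonneg (α := ℝ)])).continuousAt.continuousWithinAt
  have h2 := intervalIntegral.sum_integral_adjacent_intervals (μ := volume)
    (f := g) (a := fun n : ℕ => a + n) (n := N) (fun k _ => hcg k)
  simp only [Nat.cast_zero, add_zero] at h1 h2
  rw [← h1, ← h2]
  have h3 : ∀ M : ℕ, ∑ k ∈ Finset.range M, (g (a + k) + g (a + (k + 1 : ℕ))) =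
      (2 : ℝ) • (∑ k ∈ Finset.range M, g (a + k)) - g a + g (a + M) := by
    intro M
    induction M with
    | zero => simp
    | succ M ih => rw [Finset.sum_range_succ, ih, Finset.sum_range_succ]; module
  rw [← h3, Finset.smul_sum, ← Finset.sum_sub_distrib]
  refine Finset.sum_congr rfl fun k _ => ?_
  simpa using (key k).2

theorem tendsto_sum_sub_integral (hg : ∀ y, a ≤ y → HasDerivAt g (g' y) y)
    (hg' : ∀ y, a ≤ y → HasDerivAt g' (g'' y) y) (hg'' : ContinuousOn g'' (Ici a))
    (hint : IntegrableOn g'' (Ioi a)) :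
    Tendsto (fun N : ℕ => (2 : ℝ) • (∑ k ∈ Finset.range N, g (a + k)) - g a + g (a + N)
        - (2 : ℝ) • ∫ y in a..(a + N), g y) atTop
      (𝓝 (∫ y in Ioi a, trapezoidWeight (y - a) • g'' y)) := by
  have hi : IntegrableOn (fun y => trapezoidWeight (y - a) • g'' y) (Ioi a) := by
    refine Integrable.bdd_smul (𝕜 := ℝ) hint 1 ?_ ?_
    · exact (measurable_trapezoidWeight.comp (measurable_id.sub_const a)).aestronglyMeasurable
    · refine Eventually.of_forall fun y => ?_
      rw [Real.norm_of_nonneg (trapezoidWeight_nonneg _)]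
      exact trapezoidWeight_le_one _
  have := intervalIntegral_tendsto_integral_Ioi (l := atTop) (b := fun N : ℕ => a + (N : ℝ)) a hi
    (tendsto_atTop_add_const_left _ _ tendsto_natCast_atTop_atTop)
  simpa only [integral_trapezoidWeight_smul hg hg' hg''] using this

end Trapezoid

/-! ### The digamma function -/

theorem realDigamma_eq_deriv {x : ℝ} (hx : 0 < x) :
    HasDerivAt (fun x => Real.log (Real.Gamma x)) (realDigamma x) x := by
  have hd : DifferentiableAt ℝ Real.Gamma x := Real.differentiableAt_Gamma fun m => by
    have : (0 : ℝ) ≤ m := m.cast_nonneg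
    linarith
  exact hd.hasDerivAt.log (Real.Gamma_pos_of_pos hx).ne'

theorem log_Gamma_add_one {x : ℝ} (hx : 0 < x) :
    Real.log (Real.Gamma (x + 1)) = Real.log x + Real.log (Real.Gamma x) := by
  rw [Real.Gamma_add_one hx.ne', Real.log_mul hx.ne' (Real.Gamma_pos_of_pos hx).ne']

theorem realDigamma_add_one {x : ℝ} (hx : 0 < x) :
    realDigamma (x + 1) = realDigamma x + 1 / x := by
  have h1 : HasDerivAt (fun y => Real.log (Real.Gamma (y + 1))) (realDigamma (x + 1)) x :=
    (realDigamma_eq_deriv (by linarith : 0 < x + 1)).comp_add_const x 1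
  have h2 := (Real.hasDerivAt_log hx.ne').add (realDigamma_eq_deriv hx)
  have h3 := h2.congr_of_eventuallyEq (f₁ := fun y => Real.log (Real.Gamma (y + 1))) (by
    filter_upwards [lt_mem_nhds hx] with y hy
    exact log_Gamma_add_one hy)
  rw [h1.unique h3, one_div, add_comm]

theorem realDigamma_add_nat {x : ℝ} (hx : 0 < x) (N : ℕ) :
    realDigamma (x + N) = realDigamma x + ∑ k ∈ Finset.range N, 1 / (x + k) := by
  induction N with
  | zero => simp
  | succ N ih =>
    rw [Finset.sum_range_succ, ← add_assoc, ← ih, ← realDigamma_add_one (by positivity)]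
    push_cast
    ring_nf

/-- By convexity of log Γ, ψ(x) is at most the slope of log Γ over [x, x + 1], which is log x by the
functional equation. The lower bound below compares the same slope with ψ(x + 1). -/
theorem realDigamma_le_log {x : ℝ} (hx : 0 < x) : realDigamma x ≤ Real.log x := by
  have h := Real.convexOn_log_Gamma.deriv_le_slope (x := x) (y := x + 1) hx
    (mem_Ioi.mpr (by linarith)) (by linarith) (realDigamma_eq_deriv hx).differentiableAt
  have h2 : deriv (Real.log ∘ Real.Gamma) x = realDigamma x := (realDigamma_eq_deriv hx).deriv
  rw [h2, slope_def_field] at h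
  simpa [log_Gamma_add_one hx] using h

theorem log_le_realDigamma_add {x : ℝ} (hx : 0 < x) : Real.log x ≤ realDigamma x + 1 / x := by
  have h := Real.convexOn_log_Gamma.slope_le_deriv (x := x) (y := x + 1) hx
    (mem_Ioi.mpr (by linarith)) (by linarith)
    (realDigamma_eq_deriv (by linarith : 0 < x + 1)).differentiableAt
  have h2 : deriv (Real.log ∘ Real.Gamma) (x + 1) = realDigamma (x + 1) :=
    (realDigamma_eq_deriv (by linarith : 0 < x + 1)).deriv
  rw [h2, slope_def_field, realDigamma_add_one hx] at h
  simpa [log_Gamma_add_one hx] using h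

theorem tendsto_realDigamma_sub_log :
    Tendsto (fun x => realDigamma x - Real.log x) atTop (𝓝 0) := by
  have h : Tendsto (fun x : ℝ => -(1 / x)) atTop (𝓝 0) := by
    simpa using (tendsto_inv_atTop_zero (𝕜 := ℝ)).neg
  refine tendsto_of_tendsto_of_tendsto_of_le_of_le' h tendsto_const_nhds ?_ ?_
  · filter_upwards [eventually_gt_atTop 0] with x hx
    linarith [log_le_realDigamma_add hx]
  · filter_upwards [eventually_gt_atTop 0] with x hx
    linarith [realDigamma_le_log hx]

/-- Binet-type formula for the digamma function. -/
theorem realDigamma_sub_log_add {u t : ℝ} (hu : 0 < u) (ht : 0 ≤ t) :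
    realDigamma (t + u) - Real.log (t + u) + 1 / (2 * (t + u)) =
      -∫ y in Ioi u, trapezoidWeight (y - u) / (t + y) ^ 3 := by
  have hpos : ∀ y, u ≤ y → 0 < t + y := fun y hy => by linarith
  have h0 : ∀ y : ℝ, HasDerivAt (fun y => t + y) 1 y := fun y => (hasDerivAt_id y).const_add t
  have hg : ∀ y, u ≤ y → HasDerivAt (fun y => 1 / (t + y)) (-1 / (t + y) ^ 2) y := by
    intro y hy
    simpa [one_div] using (h0 y).fun_inv (hpos y hy).ne'
  have hg' : ∀ y, u ≤ y → HasDerivAt (fun y => -1 / (t + y) ^ 2) (2 / (t + y) ^ 3) y := by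
    intro y hy
    have := (hpos y hy).ne'
    refine ((hasDerivAt_const y (-1 : ℝ)).div ((h0 y).pow 2) (pow_ne_zero 2 this)).congr_deriv ?_
    simp only [Pi.pow_apply]
    field_simp
    ring
  have hc : ContinuousOn (fun y => 2 / (t + y) ^ 3) (Ici u) := by
    refine continuousOn_const.div (by fun_prop) fun y hy => (pow_pos (hpos y hy) 3).ne'
  have hlim : Tendsto (fun y : ℝ => -1 / (t + y) ^ 2) atTop (𝓝 0) := by
    refine tendsto_const_nhds.div_atTop ?_
    exact (tendsto_pow_atTop two_ne_zero).comp (tendsto_atTop_add_const_left _ _ tendsto_id)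
  have hint : IntegrableOn (fun y => 2 / (t + y) ^ 3) (Ioi u) := by
    refine integrableOn_Ioi_deriv_of_nonneg' hg' (fun y hy => ?_) hlim
    have := hpos y (le_of_lt hy)
    positivity
  have hT := tendsto_sum_sub_integral hg hg' hc hint
  have hux : 0 < t + u := by linarith
  -- By the recurrence for ψ, the sum of 1/(t+u+k) is ψ(t+u+N) - ψ(t+u), so the trapezoidal
  -- expression takes this form and ψ - log → 0 gives its limit.
  have hT2 : Tendsto (fun N : ℕ => 2 * (realDigamma ((t + u) + N) - Real.log ((t + u) + N))
      + 1 / ((t + u) + N) + (-2 * realDigamma (t + u) + 2 * Real.log (t + u) - 1 / (t + u)))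
      atTop (𝓝 (2 * 0 + 0 + (-2 * realDigamma (t + u) + 2 * Real.log (t + u) - 1 / (t + u)))) := by
    have hN : Tendsto (fun N : ℕ => (t + u) + (N : ℝ)) atTop atTop :=
      tendsto_atTop_add_const_left _ _ tendsto_natCast_atTop_atTop
    refine (((tendsto_realDigamma_sub_log.comp hN).const_mul 2).add ?_).add_const _
    exact tendsto_const_nhds.div_atTop hN
  have hEq := tendsto_nhds_unique hT (hT2.congr fun N => ?_)
  · have e : ∫ y in Ioi u, trapezoidWeight (y - u) • (2 / (t + y) ^ 3) =
        2 * ∫ y in Ioi u, trapezoidWeight (y - u) / (t + y) ^ 3 := by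
      rw [← integral_const_mul]
      refine integral_congr_ae (Eventually.of_forall fun y => ?_)
      simp only [smul_eq_mul]
      ring
    rw [e] at hEq
    have e2 : 1 / (2 * (t + u)) = 1 / (t + u) / 2 := by field_simp
    rw [e2]
    linarith
  · have hI : ∫ y in u..(u + N), 1 / (t + y) = Real.log (t + u + N) - Real.log (t + u) := by
      have hNn : (0 : ℝ) ≤ N := N.cast_nonneg
      rw [intervalIntegral.integral_comp_add_left (fun y => 1 / y) t, integral_one_div,
        Real.log_div, add_assoc]
      · positivity
      · positivity
      · rw [uIcc_of_le (by linarith)]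
        exact fun h => absurd h.1 (by linarith)
    rw [realDigamma_add_nat hux, hI]
    simp only [smul_eq_mul, add_assoc]
    ring

/-! ### The weight integral as a Mellin transform -/

/-- The weight `y ↦ {y - u} (1 - {y - u})`, restricted to `y > u`. -/
noncomputable def shiftedWeight (u : ℝ) : ℝ → ℂ :=
  (Ioi u).indicator fun y => (trapezoidWeight (y - u) : ℂ)

/-- The integral `∫ {y - u} (1 - {y - u}) y ^ (-s - 2) dy` over `y > u`. -/
noncomputable def weightIntegral (u : ℝ) (s : ℂ) : ℂ := mellin (shiftedWeight u) (-1 - s)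

theorem norm_shiftedWeight_le (u y : ℝ) : ‖shiftedWeight u y‖ ≤ 1 := by
  unfold shiftedWeight
  refine (norm_indicator_le_norm_self _ _).trans ?_
  rw [Complex.norm_real, Real.norm_of_nonneg (trapezoidWeight_nonneg _)]
  exact trapezoidWeight_le_one _

theorem measurable_shiftedWeight (u : ℝ) : Measurable (shiftedWeight u) :=
  (Complex.measurable_ofReal.comp
    (measurable_trapezoidWeight.comp (measurable_id.sub_const u))).indicator measurableSet_Ioi

theorem weightIntegral_eq {u : ℝ} (hu : 0 < u) (s : ℂ) :
    weightIntegral u s = ∫ y in Ioi u, (trapezoidWeight (y - u) : ℂ) * (y : ℂ) ^ (-s - 2) := by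
  unfold weightIntegral mellin
  rw [setIntegral_eq_of_subset_of_forall_sdiff_eq_zero measurableSet_Ioi
    (Ioi_subset_Ioi hu.le)]
  · refine setIntegral_congr_fun measurableSet_Ioi fun y hy => ?_
    simp only [shiftedWeight, indicator_of_mem hy, smul_eq_mul]
    rw [show -1 - s - 1 = -s - 2 by ring, mul_comm]
  · intro y hy
    simp [shiftedWeight, indicator_of_notMem hy.2]

theorem mellin_log_shiftedWeight {u : ℝ} (hu : 0 < u) (s : ℂ) :
    mellin (fun t => Real.log t • shiftedWeight u t) (-1 - s) =
      ∫ y in Ioi u, (trapezoidWeight (y - u) : ℂ) * (Real.log y : ℂ) * (y : ℂ) ^ (-s - 2) := by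
  unfold mellin
  rw [setIntegral_eq_of_subset_of_forall_sdiff_eq_zero measurableSet_Ioi
    (Ioi_subset_Ioi hu.le)]
  · refine setIntegral_congr_fun measurableSet_Ioi fun y hy => ?_
    simp only [shiftedWeight, indicator_of_mem hy, smul_eq_mul, Complex.real_smul]
    rw [show -1 - s - 1 = -s - 2 by ring]
    ring
  · intro y hy
    simp [shiftedWeight, indicator_of_notMem hy.2]

theorem hasDerivAt_mellin_shiftedWeight {u : ℝ} (hu : 0 < u) {z : ℂ} (hz : z.re < 0) :
    MellinConvergent (fun t => Real.log t • shiftedWeight u t) z ∧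
    HasDerivAt (mellin (shiftedWeight u))
      (mellin (fun t => Real.log t • shiftedWeight u t) z) z := by
  -- The weight is bounded at infinity, hence exponent 0. It vanishes near 0, so any exponent below
  -- Re z serves there.
  refine mellin_hasDerivAt_of_isBigO_rpow (a := 0) (b := z.re - 1) ?_ ?_ hz ?_ (by linarith)
  · refine LocallyIntegrable.locallyIntegrableOn ?_ _
    refine (locallyIntegrable_const (1 : ℝ)).mono
      (measurable_shiftedWeight u).aestronglyMeasurable (Eventually.of_forall fun y => ?_)
    simpa using norm_shiftedWeight_le u y
  · refine Asymptotics.IsBigO.of_bound 1 (Eventually.of_forall fun y => ?_)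
    simpa using norm_shiftedWeight_le u y
  · refine Asymptotics.IsBigO.of_bound 1 ?_
    filter_upwards [mem_nhdsWithin_of_mem_nhds (gt_mem_nhds hu)] with y hy
    rw [shiftedWeight, indicator_of_notMem (by simpa using hy.le)]
    simp only [norm_zero]
    positivity

theorem hasDerivAt_weightIntegral {u : ℝ} (hu : 0 < u) {s : ℂ} (hs : -1 < s.re) :
    HasDerivAt (weightIntegral u)
      (-mellin (fun t => Real.log t • shiftedWeight u t) (-1 - s)) s := by
  have h := (hasDerivAt_mellin_shiftedWeight hu (z := -1 - s) (by simp; linarith)).2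
  have h2 : HasDerivAt (fun s : ℂ => -1 - s) (-1) s := (hasDerivAt_id s).const_sub (-1)
  exact (h.comp s h2).congr_deriv (by ring)

theorem tendsto_ofReal_cpow_zero {u : ℝ} (hu : 0 < u) {z : ℂ} (hz : z.re < 0) :
    Tendsto (fun N : ℕ => ((u + N : ℝ) : ℂ) ^ z) atTop (𝓝 0) := by
  rw [tendsto_zero_iff_norm_tendsto_zero]
  have hN : Tendsto (fun N : ℕ => u + (N : ℝ)) atTop atTop :=
    tendsto_atTop_add_const_left _ _ tendsto_natCast_atTop_atTop
  have h := (tendsto_rpow_neg_atTop (y := -z.re) (by linarith)).comp hN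
  refine h.congr fun N => ?_
  rw [Complex.norm_cpow_eq_rpow_re_of_pos (by positivity)]
  simp

theorem hasDerivAt_ofReal_cpow_of_pos {y : ℝ} (hy : 0 < y) (r : ℂ) :
    HasDerivAt (fun y : ℝ => (y : ℂ) ^ r) (r * (y : ℂ) ^ (r - 1)) y := by
  rcases eq_or_ne r 0 with rfl | hr
  · simpa using hasDerivAt_const y (1 : ℂ)
  · exact hasDerivAt_ofReal_cpow_const hy.ne' hr

/-! ### Continuation of the Hurwitz zeta function to Re s > -1 -/

/-- The analytic continuation of the Hurwitz zeta function given by the trapezoidal rule. -/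
noncomputable def trapezoidZeta (u : ℝ) (s : ℂ) : ℂ :=
  (u : ℂ) ^ (-s) / 2 + (u : ℂ) ^ (1 - s) / (s - 1) + s * (s + 1) / 2 * weightIntegral u s

theorem hurwitzZetaPos_eq_of_one_lt_re {u : ℝ} (hu : 0 < u) {s : ℂ} (hs : 1 < s.re) :
    hurwitzZetaPos u s = trapezoidZeta u s := by
  have hs1 : s - 1 ≠ 0 := sub_ne_zero.mpr (by rintro rfl; simp at hs)
  have hg : ∀ y, u ≤ y → HasDerivAt (fun y : ℝ => (y : ℂ) ^ (-s)) (-s * (y : ℂ) ^ (-s - 1)) y :=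
    fun y hy => hasDerivAt_ofReal_cpow_of_pos (hu.trans_le hy) _
  have hg' : ∀ y, u ≤ y → HasDerivAt (fun y : ℝ => -s * (y : ℂ) ^ (-s - 1))
      (s * (s + 1) * (y : ℂ) ^ (-s - 2)) y := by
    intro y hy
    refine ((hasDerivAt_ofReal_cpow_of_pos (hu.trans_le hy) (-s - 1)).const_mul (-s)).congr_deriv ?_
    rw [show -s - 1 - 1 = -s - 2 by ring]
    ring
  have hg'' : ContinuousOn (fun y : ℝ => s * (s + 1) * (y : ℂ) ^ (-s - 2)) (Ici u) :=
    fun y hy => ((hasDerivAt_ofReal_cpow_of_pos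
      (hu.trans_le hy) _).continuousAt.const_mul _).continuousWithinAt
  have hint : IntegrableOn (fun y : ℝ => s * (s + 1) * (y : ℂ) ^ (-s - 2)) (Ioi u) :=
    (integrableOn_Ioi_cpow_of_lt (by simp; linarith) hu).const_mul _
  have hT := tendsto_sum_sub_integral hg hg' hg'' hint
  have hsum := (hasSum_hurwitzZetaPos hu hs).tendsto_sum_nat
  have hT2 : Tendsto (fun N : ℕ => 2 * (∑ k ∈ Finset.range N, 1 / ((k : ℂ) + (u : ℂ)) ^ s)
      - (u : ℂ) ^ (-s) + ((u + N : ℝ) : ℂ) ^ (-s)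
      - 2 * ((((u + N : ℝ) : ℂ) ^ (1 - s) - (u : ℂ) ^ (1 - s)) / (1 - s))) atTop
      (𝓝 (2 * hurwitzZetaPos u s - (u : ℂ) ^ (-s) + 0
      - 2 * ((0 - (u : ℂ) ^ (1 - s)) / (1 - s)))) := by
    refine (((hsum.const_mul 2).sub_const _).add
      (tendsto_ofReal_cpow_zero hu (by simp; linarith))).sub (Tendsto.const_mul 2 ?_)
    exact ((tendsto_ofReal_cpow_zero hu (by simp; linarith)).sub_const _).div_const _
  have hEq := tendsto_nhds_unique hT (hT2.congr fun N => ?_)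
  · have e : ∫ y in Ioi u, trapezoidWeight (y - u) • (s * (s + 1) * (y : ℂ) ^ (-s - 2)) =
        s * (s + 1) * weightIntegral u s := by
      rw [weightIntegral_eq hu, ← integral_const_mul]
      refine integral_congr_ae (Eventually.of_forall fun y => ?_)
      simp only [Complex.real_smul]
      ring
    rw [e] at hEq
    have e2 : (0 - (u : ℂ) ^ (1 - s)) / (1 - s) = (u : ℂ) ^ (1 - s) / (s - 1) := by
      rw [← neg_sub s 1, zero_sub, neg_div_neg_eq]
    rw [e2] at hEq
    unfold trapezoidZeta
    linear_combination -hEq / 2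
  · have hNn : (0 : ℝ) ≤ N := N.cast_nonneg
    have hI : ∫ y in u..(u + N), (y : ℂ) ^ (-s) =
        (((u + N : ℝ) : ℂ) ^ (1 - s) - (u : ℂ) ^ (1 - s)) / (1 - s) := by
      rw [integral_cpow, show -s + 1 = 1 - s by ring]
      refine Or.inr ⟨fun h => hs1 (by linear_combination -h), ?_⟩
      rw [uIcc_of_le (by linarith)]
      exact fun h => absurd h.1 (by linarith)
    rw [hI]
    simp only [Complex.real_smul]
    have hk : ∀ k ∈ Finset.range N, 1 / ((k : ℂ) + (u : ℂ)) ^ s = ((u + k : ℝ) : ℂ) ^ (-s) := by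
      intro k _
      rw [Complex.cpow_neg, one_div]
      push_cast
      rw [add_comm]
    rw [Finset.sum_congr rfl hk]
    push_cast
    ring

/-- The punctured half-plane is a union of four convex pieces: the parts above and below the real
axis, the strip left of Re s = 1 and the half-plane right of it. They are glued at i, 2 + i and -i.
-/
theorem isPreconnected_halfPlane_diff_one : IsPreconnected {s : ℂ | -1 < s.re ∧ s ≠ 1} := by
  have hA : IsPreconnected {s : ℂ | -1 < s.re ∧ s.re < 1} :=
    ((convex_halfSpace_re_gt (-1)).inter (convex_halfSpace_re_lt 1)).isPreconnected
  have hB : IsPreconnected {s : ℂ | 1 < s.re} := (convex_halfSpace_re_gt 1).isPreconnected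
  have hC : IsPreconnected {s : ℂ | -1 < s.re ∧ 0 < s.im} :=
    ((convex_halfSpace_re_gt (-1)).inter (convex_halfSpace_im_gt 0)).isPreconnected
  have hD : IsPreconnected {s : ℂ | -1 < s.re ∧ s.im < 0} :=
    ((convex_halfSpace_re_gt (-1)).inter (convex_halfSpace_im_lt 0)).isPreconnected
  have h1 := hC.union (⟨0, 1⟩ : ℂ) (by simp) (by simp) hA
  have h2 := h1.union (⟨2, 1⟩ : ℂ) (by norm_num) (by simp) hB
  have h3 := h2.union (⟨0, -1⟩ : ℂ) (by simp) (by simp) hD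
  convert h3 using 1
  ext s
  simp only [mem_ofPred_eq, mem_union, ne_eq, Complex.ext_iff, Complex.one_re, Complex.one_im]
  constructor
  · rintro ⟨h, h'⟩
    rcases lt_trichotomy s.im 0 with hi | hi | hi
    · exact Or.inr ⟨h, hi⟩
    · rcases lt_trichotomy s.re 1 with hr | hr | hr
      · exact Or.inl (Or.inl (Or.inr ⟨h, hr⟩))
      · exact absurd ⟨hr, hi⟩ h'
      · exact Or.inl (Or.inr hr)
    · exact Or.inl (Or.inl (Or.inl ⟨h, hi⟩))
  · rintro (((⟨h, h'⟩ | ⟨h, h'⟩) | h) | ⟨h, h'⟩)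
    · exact ⟨h, fun e => by linarith [e.2]⟩
    · exact ⟨h, fun e => by linarith [e.1]⟩
    · exact ⟨by linarith, fun e => by linarith [e.1]⟩
    · exact ⟨h, fun e => by linarith [e.2]⟩

theorem isOpen_halfPlane_diff_one : IsOpen {s : ℂ | -1 < s.re ∧ s ≠ 1} :=
  (isOpen_lt continuous_const Complex.continuous_re).inter isOpen_ne

theorem hasDerivAt_ofReal_const_cpow_neg {u : ℝ} (hu : 0 < u) (c s : ℂ) :
    HasDerivAt (fun s : ℂ => (u : ℂ) ^ (c - s)) (-(Real.log u : ℂ) * (u : ℂ) ^ (c - s)) s := by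
  have hne : (u : ℂ) ≠ 0 := by exact_mod_cast hu.ne'
  have h := ((hasDerivAt_id s).const_sub c).const_cpow (c := (u : ℂ)) (Or.inl hne)
  refine h.congr_deriv ?_
  rw [Complex.ofReal_log hu.le]
  simp only [id]
  ring

theorem hasDerivAt_trapezoidZeta {u : ℝ} (hu : 0 < u) {s : ℂ} (hs : -1 < s.re) (hs1 : s ≠ 1) :
    HasDerivAt (trapezoidZeta u)
      (-(Real.log u : ℂ) * (u : ℂ) ^ (0 - s) / 2
        + ((-(Real.log u : ℂ) * (u : ℂ) ^ (1 - s)) * (s - 1) - (u : ℂ) ^ (1 - s) * 1) / (s - 1) ^ 2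
        + ((s + 1 / 2) * weightIntegral u s + s * (s + 1) / 2 * deriv (weightIntegral u) s)) s := by
  have h1 := (hasDerivAt_ofReal_const_cpow_neg hu 0 s).div_const 2
  have h2 := (hasDerivAt_ofReal_const_cpow_neg hu 1 s).div ((hasDerivAt_id s).sub_const 1)
    (sub_ne_zero.mpr hs1)
  have h3 : HasDerivAt (fun s : ℂ => s * (s + 1) / 2) (s + 1 / 2) s := by
    refine (((hasDerivAt_id s).mul ((hasDerivAt_id s).add_const 1)).div_const 2).congr_deriv ?_
    simp only [id]
    ring
  have h4 := h3.mul (hasDerivAt_weightIntegral hu hs).differentiableAt.hasDerivAt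
  refine ((h1.add h2).add h4).congr_of_eventuallyEq (Eventually.of_forall fun z => ?_)
  simp [trapezoidZeta]

theorem hurwitzZetaPos_eq_trapezoidZeta {u : ℝ} (hu : 0 < u) :
    EqOn (hurwitzZetaPos u) (trapezoidZeta u) {s : ℂ | -1 < s.re ∧ s ≠ 1} := by
  have h2 : (2 : ℂ) ∈ {s : ℂ | -1 < s.re ∧ s ≠ 1} := by
    constructor <;> norm_num
  refine AnalyticOnNhd.eqOn_of_preconnected_of_eventuallyEq (𝕜 := ℂ) ?_ ?_
    isPreconnected_halfPlane_diff_one h2 ?_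
  · have hd : DifferentiableOn ℂ (hurwitzZetaPos u) {s : ℂ | -1 < s.re ∧ s ≠ 1} := fun s hs =>
      (differentiableAt_hurwitzZetaPos hu hs.2).differentiableWithinAt
    exact hd.analyticOnNhd isOpen_halfPlane_diff_one
  · have hd : DifferentiableOn ℂ (trapezoidZeta u) {s : ℂ | -1 < s.re ∧ s ≠ 1} := fun s hs =>
      (hasDerivAt_trapezoidZeta hu hs.1 hs.2).differentiableAt.differentiableWithinAt
    exact hd.analyticOnNhd isOpen_halfPlane_diff_one
  · filter_upwards [(isOpen_lt continuous_const Complex.continuous_re).mem_nhds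
      (show (1 : ℝ) < (2 : ℂ).re by norm_num)] with s hs
    exact hurwitzZetaPos_eq_of_one_lt_re hu hs

/-! ### The second derivative at 0 -/

/-- The left side is the second derivative of s(s+1)/2 · W(s) at 0. -/
theorem weightIntegral_zero_add_deriv {u : ℝ} (hu : 0 < u) :
    weightIntegral u 0 + deriv (weightIntegral u) 0 =
      ((∫ y in Ioi u, trapezoidWeight (y - u) * ((1 - Real.log y) / y ^ 2) : ℝ) : ℂ) := by
  have hd := (hasDerivAt_weightIntegral hu (s := 0) (by simp)).deriv
  have hneg : (-1 - (0 : ℂ)).re < 0 := by simp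
  have hpow : ∀ y : ℝ, y ∈ Ioi u → (y : ℂ) ^ (-(0 : ℂ) - 2) = 1 / (y : ℂ) ^ 2 := by
    intro y _
    rw [show -(0 : ℂ) - 2 = -((2 : ℕ) : ℂ) by simp, Complex.cpow_neg, Complex.cpow_natCast, one_div]
  have hconv2 := (hasDerivAt_mellin_shiftedWeight hu hneg).1
  rw [hd, mellin_log_shiftedWeight hu, weightIntegral_eq hu, ← sub_eq_add_neg, ← integral_sub]
  · rw [← integral_complex_ofReal]
    refine setIntegral_congr_fun measurableSet_Ioi fun y hy => ?_
    rw [hpow y hy]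
    push_cast
    ring
  · have hpi : IntegrableOn (fun y : ℝ => (y : ℂ) ^ (-(0 : ℂ) - 2)) (Ioi u) :=
      integrableOn_Ioi_cpow_of_lt (by simp) hu
    refine Integrable.bdd_mul (c := 1) hpi ?_ ?_
    · exact (Complex.measurable_ofReal.comp (measurable_trapezoidWeight.comp
        (measurable_id.sub_const u))).aestronglyMeasurable
    · refine Eventually.of_forall fun y => ?_
      rw [Complex.norm_real, Real.norm_of_nonneg (trapezoidWeight_nonneg _)]
      exact trapezoidWeight_le_one _
  · refine (IntegrableOn.mono_set hconv2 (Ioi_subset_Ioi hu.le)).congr_fun (fun y hy => ?_)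
      measurableSet_Ioi
    simp only [shiftedWeight, indicator_of_mem hy, smul_eq_mul, Complex.real_smul]
    rw [show -1 - (0 : ℂ) - 1 = -0 - 2 by ring]
    ring

theorem iteratedDeriv_two_hurwitzZetaPos_zero {u : ℝ} (hu : 0 < u) :
    iteratedDeriv 2 (hurwitzZetaPos u) 0 =
      (((1 / 2 - u) * Real.log u ^ 2 + 2 * u * Real.log u - 2 * u +
        ∫ y in Ioi u, trapezoidWeight (y - u) * ((1 - Real.log y) / y ^ 2) : ℝ) : ℂ) := by
  have h0 : (0 : ℂ) ∈ {s : ℂ | -1 < s.re ∧ s ≠ 1} := by constructor <;> norm_num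
  have hnhds := isOpen_halfPlane_diff_one.mem_nhds h0
  have heq : hurwitzZetaPos u =ᶠ[𝓝 0] trapezoidZeta u :=
    (hurwitzZetaPos_eq_trapezoidZeta hu).eventuallyEq_of_mem hnhds
  rw [iteratedDeriv_succ, iteratedDeriv_one, heq.deriv.deriv_eq]
  have heq2 : deriv (trapezoidZeta u) =ᶠ[𝓝 0] fun s =>
      -(Real.log u : ℂ) * (u : ℂ) ^ (0 - s) / 2
        + ((-(Real.log u : ℂ) * (u : ℂ) ^ (1 - s)) * (s - 1) - (u : ℂ) ^ (1 - s) * 1) / (s - 1) ^ 2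
        + ((s + 1 / 2) * weightIntegral u s + s * (s + 1) / 2 * deriv (weightIntegral u) s) := by
    filter_upwards [hnhds] with s hs
    exact (hasDerivAt_trapezoidZeta hu hs.1 hs.2).deriv
  rw [heq2.deriv_eq]
  have hW : HasDerivAt (weightIntegral u) (deriv (weightIntegral u) 0) 0 :=
    (hasDerivAt_weightIntegral hu (by simp)).differentiableAt.hasDerivAt
  -- Only the existence of W''(0) matters: its coefficient s(s+1)/2 vanishes at 0.
  have hW2 : HasDerivAt (deriv (weightIntegral u)) (deriv (deriv (weightIntegral u)) 0) 0 := by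
    have han : AnalyticOnNhd ℂ (weightIntegral u) {s : ℂ | -1 < s.re} :=
      DifferentiableOn.analyticOnNhd (fun s hs =>
        (hasDerivAt_weightIntegral hu hs).differentiableAt.differentiableWithinAt)
        (isOpen_lt continuous_const Complex.continuous_re)
    exact (han.deriv 0 (by simp)).differentiableAt.hasDerivAt
  have h1 := ((hasDerivAt_ofReal_const_cpow_neg hu 0 0).const_mul
    (-(Real.log u : ℂ))).div_const 2
  have hid : HasDerivAt (fun s : ℂ => s - 1) 1 0 := (hasDerivAt_id 0).sub_const 1
  have hp := hasDerivAt_ofReal_const_cpow_neg hu 1 0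
  have h2 := (((hp.const_mul (-(Real.log u : ℂ))).mul hid).sub (hp.mul_const 1)).div
    (hid.pow 2) (by simp)
  have hid2 : HasDerivAt (fun s : ℂ => s + 1 / 2) 1 0 := (hasDerivAt_id 0).add_const _
  have h3 : HasDerivAt (fun s : ℂ => s * (s + 1) / 2) (1 / 2) 0 := by
    refine (((hasDerivAt_id (0 : ℂ)).mul ((hasDerivAt_id 0).add_const 1)).div_const 2).congr_deriv ?_
    simp
  have h4 := (hid2.mul hW).add (h3.mul hW2)
  refine (((h1.add h2).add h4).deriv).trans ?_
  rw [Complex.ofReal_add, ← weightIntegral_zero_add_deriv hu]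
  simp only [Pi.mul_apply, Pi.sub_apply, Pi.pow_apply, sub_zero, Complex.cpow_zero,
    Complex.cpow_one]
  push_cast
  ring

/-! ### The logarithmic kernel and the exchange of integrals -/

theorem integrableOn_abs_log_mul_rpow {c : ℝ} (hc : 0 < c) :
    IntegrableOn (fun t => |Real.log t| * (t + c) ^ (-(3 / 2) : ℝ)) (Ioi 0) := by
  have hm : Measurable (fun t : ℝ => |Real.log t| * (t + c) ^ (-(3 / 2) : ℝ)) := by
    have : Measurable fun t : ℝ => (t + c) ^ (-(3 / 2) : ℝ) :=
      (measurable_id.add_const c).pow_const _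
    exact (continuous_abs.measurable.comp Real.measurable_log).mul this
  have hlog : IntegrableOn Real.log (Ioc 0 1) :=
    (intervalIntegrable_iff_integrableOn_Ioc_of_le zero_le_one).mp
      intervalIntegral.intervalIntegrable_log'
  rw [← Ioc_union_Ioi_eq_Ioi zero_le_one]
  refine IntegrableOn.union ?_ ?_
  · refine Integrable.mono' (hlog.norm.mul_const (c ^ (-(3 / 2) : ℝ)))
      hm.aestronglyMeasurable (ae_restrict_of_forall_mem measurableSet_Ioc fun t ht => ?_)
    have h1 : (t + c) ^ (-(3 / 2) : ℝ) ≤ c ^ (-(3 / 2) : ℝ) :=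
      Real.rpow_le_rpow_of_nonpos hc (by linarith [ht.1]) (by norm_num)
    have h2 : 0 ≤ (t + c) ^ (-(3 / 2) : ℝ) := Real.rpow_nonneg (by linarith [ht.1]) _
    rw [norm_mul, Real.norm_of_nonneg h2, norm_abs_eq_norm]
    gcongr
  · have hi : IntegrableOn (fun t : ℝ => 4 * t ^ (-(5 / 4) : ℝ)) (Ioi 1) :=
      (integrableOn_Ioi_rpow_of_lt (by norm_num) one_pos).const_mul 4
    refine Integrable.mono' hi hm.aestronglyMeasurable
      (ae_restrict_of_forall_mem measurableSet_Ioi fun t (ht : 1 < t) => ?_)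
    have ht0 : 0 < t := by linarith
    have h1 : (t + c) ^ (-(3 / 2) : ℝ) ≤ t ^ (-(3 / 2) : ℝ) :=
      Real.rpow_le_rpow_of_nonpos ht0 (by linarith) (by norm_num)
    have h2 : 0 ≤ (t + c) ^ (-(3 / 2) : ℝ) := Real.rpow_nonneg (by linarith) _
    -- The exponent 1/4 keeps -3/2 + 1/4 = -5/4 below -1; the constant is 1/(1/4).
    have h3 : Real.log t ≤ 4 * t ^ (1 / 4 : ℝ) := by
      have := Real.log_le_rpow_div ht0.le (show (0 : ℝ) < 1 / 4 by norm_num)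
      linarith
    rw [norm_mul, Real.norm_of_nonneg h2, norm_abs_eq_norm,
      Real.norm_of_nonneg (Real.log_pos ht).le]
    calc Real.log t * (t + c) ^ (-(3 / 2) : ℝ) ≤ (4 * t ^ (1 / 4 : ℝ)) * t ^ (-(3 / 2) : ℝ) := by
          gcongr
      _ = 4 * t ^ (-(5 / 4) : ℝ) := by
          rw [mul_assoc, ← Real.rpow_add ht0]; norm_num

/-- Splitting the cube evenly gives a majorant that separates t from y. Each exponent 3/2 exceeds 1,
so both factors are integrable, the first even against |log t|. -/
theorem one_div_add_pow_three_le {u t y : ℝ} (hu : 0 < u) (ht : 0 ≤ t) (hy : u ≤ y) :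
    1 / (t + y) ^ 3 ≤ (t + u) ^ (-(3 / 2) : ℝ) * y ^ (-(3 / 2) : ℝ) := by
  have h0 : 0 < t + y := by linarith
  have h1 : 1 / (t + y) ^ 3 = (t + y) ^ (-(3 / 2) : ℝ) * (t + y) ^ (-(3 / 2) : ℝ) := by
    rw [← Real.rpow_add h0, show (-(3 / 2) + -(3 / 2) : ℝ) = -((3 : ℕ) : ℝ) by norm_num,
      Real.rpow_neg h0.le, Real.rpow_natCast, one_div]
  rw [h1]
  have h2 : (t + y) ^ (-(3 / 2) : ℝ) ≤ (t + u) ^ (-(3 / 2) : ℝ) :=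
    Real.rpow_le_rpow_of_nonpos (by linarith) (by linarith) (by norm_num)
  have h3 : (t + y) ^ (-(3 / 2) : ℝ) ≤ y ^ (-(3 / 2) : ℝ) :=
    Real.rpow_le_rpow_of_nonpos (by linarith) (by linarith) (by norm_num)
  have h4 : 0 ≤ (t + y) ^ (-(3 / 2) : ℝ) := Real.rpow_nonneg h0.le _
  exact mul_le_mul h2 h3 h4 (h4.trans h2)

theorem tendsto_log_sub_log_add (y : ℝ) :
    Tendsto (fun t => Real.log t - Real.log (t + y)) atTop (𝓝 0) := by
  have hty : Tendsto (fun t : ℝ => t + y) atTop atTop := tendsto_atTop_add_const_right _ _ tendsto_id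
  have h : Tendsto (fun t : ℝ => 1 - y / (t + y)) atTop (𝓝 (1 - 0)) :=
    tendsto_const_nhds.sub (tendsto_const_nhds.div_atTop hty)
  rw [sub_zero] at h
  have h2 := h.log one_ne_zero
  rw [Real.log_one] at h2
  refine h2.congr' ?_
  filter_upwards [eventually_gt_atTop 0, hty.eventually_gt_atTop 0] with t ht ht2
  rw [← Real.log_div ht.ne' ht2.ne']
  congr 1
  field_simp
  ring

theorem tendsto_log_div_self : Tendsto (fun t => Real.log t / t) atTop (𝓝 0) :=
  Real.isLittleO_log_id_atTop.tendsto_div_nhds_zero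

theorem integrableOn_log_div_pow_three {y : ℝ} (hy : 0 < y) :
    IntegrableOn (fun t => Real.log t / (t + y) ^ 3) (Ioi 0) := by
  refine Integrable.mono' ((integrableOn_abs_log_mul_rpow hy).mul_const (y ^ (-(3 / 2) : ℝ))) ?_ ?_
  · exact (Real.measurable_log.div ((measurable_id.add_const y).pow_const 3)).aestronglyMeasurable
  · refine ae_restrict_of_forall_mem measurableSet_Ioi fun t (ht : 0 < t) => ?_
    have h := one_div_add_pow_three_le hy ht.le le_rfl
    have h0 : 0 ≤ 1 / (t + y) ^ 3 := by positivity
    rw [div_eq_mul_one_div, norm_mul, Real.norm_of_nonneg h0, mul_assoc, Real.norm_eq_abs]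
    gcongr

theorem integral_log_div_pow_three {y : ℝ} (hy : 0 < y) :
    ∫ t in Ioi 0, Real.log t / (t + y) ^ 3 = (Real.log y - 1) / (2 * y ^ 2) := by
  -- Integration by parts, with 1/(2y²) - 1/(2(t+y)²) as the antiderivative of (t+y)^(-3). This
  -- choice vanishes at t = 0 and absorbs the singularity of log t.
  set A : ℝ → ℝ := fun t => (t * Real.log t) * ((t + 2 * y) / (2 * y ^ 2 * (t + y) ^ 2))
    - Real.log (t + y) / (2 * y ^ 2) + 1 / (2 * y * (t + y)) with hA
  have hA0 : A 0 = -(Real.log y - 1) / (2 * y ^ 2) := by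
    simp only [hA, zero_add, zero_mul]
    field_simp
    ring
  have hcont : ContinuousWithinAt A (Ici 0) 0 := by
    have h1 : ContinuousAt (fun t : ℝ => t * Real.log t) 0 := Real.continuous_mul_log.continuousAt
    have h2 : ContinuousAt (fun t : ℝ => (t + 2 * y) / (2 * y ^ 2 * (t + y) ^ 2)) 0 :=
      ContinuousAt.div (by fun_prop) (by fun_prop) (by simp [hy.ne'])
    have h3 : ContinuousAt (fun t : ℝ => Real.log (t + y) / (2 * y ^ 2)) 0 :=
      (ContinuousAt.log (by fun_prop) (by simp [hy.ne'])).div_const _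
    have h4 : ContinuousAt (fun t : ℝ => 1 / (2 * y * (t + y))) 0 :=
      ContinuousAt.div (by fun_prop) (by fun_prop) (by simp [hy.ne'])
    exact (((h1.mul h2).sub h3).add h4).continuousWithinAt
  have hderiv : ∀ t ∈ Ioi (0 : ℝ), HasDerivAt A (Real.log t / (t + y) ^ 3) t := by
    intro t (ht : 0 < t)
    have hty : 0 < t + y := by linarith
    have h0 : HasDerivAt (fun t : ℝ => t + y) 1 t := (hasDerivAt_id t).add_const y
    have h0' : HasDerivAt (fun t : ℝ => t + 2 * y) 1 t := (hasDerivAt_id t).add_const _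
    have h1 := (hasDerivAt_id t).mul (Real.hasDerivAt_log ht.ne')
    have h2 := h0'.div ((h0.pow 2).const_mul (2 * y ^ 2))
      (by simpa using ⟨hy.ne', hty.ne'⟩)
    have h3 := (h0.log hty.ne').div_const (2 * y ^ 2)
    have h4 := (hasDerivAt_const t (1 : ℝ)).div (h0.const_mul (2 * y)) (by positivity)
    refine (((h1.mul h2).sub h3).add h4).congr_deriv ?_
    simp only [id, Pi.mul_apply, Pi.div_apply, Pi.pow_apply]
    field_simp
    ring
  have hlim : Tendsto A atTop (𝓝 0) := by
    have hty : Tendsto (fun t : ℝ => t + y) atTop atTop :=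
      tendsto_atTop_add_const_right _ _ tendsto_id
    have h1 := (tendsto_log_sub_log_add y).div_const (2 * y ^ 2)
    have h2 : Tendsto (fun t => Real.log t / (2 * (t + y) ^ 2)) atTop (𝓝 0) := by
      refine squeeze_zero' (g := fun t => Real.log t / t) ?_ ?_ tendsto_log_div_self
      · filter_upwards [eventually_ge_atTop 1] with t ht
        exact div_nonneg (Real.log_nonneg ht) (by positivity)
      · filter_upwards [eventually_ge_atTop 1] with t ht
        refine div_le_div_of_nonneg_left (Real.log_nonneg ht) (by linarith) ?_
        nlinarith
    have h3 : Tendsto (fun t : ℝ => 1 / (2 * y * (t + y))) atTop (𝓝 0) :=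
      tendsto_const_nhds.div_atTop (hty.const_mul_atTop (by positivity))
    have h4 := (h1.sub h2).add h3
    simp only [zero_div, sub_zero, add_zero] at h4
    refine h4.congr' ?_
    filter_upwards [eventually_gt_atTop 0] with t ht
    simp only [hA]
    field_simp
    ring
  rw [integral_Ioi_of_hasDerivAt_of_tendsto hcont hderiv (integrableOn_log_div_pow_three hy) hlim,
    hA0]
  ring

theorem integrable_weight_kernel {u : ℝ} (hu : 0 < u) :
    Integrable (Function.uncurry fun t y : ℝ =>
      trapezoidWeight (y - u) / (t + y) ^ 3 * Real.log t)
      ((volume.restrict (Ioi 0)).prod (volume.restrict (Ioi u))) := by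
  have hi : IntegrableOn (fun y : ℝ => y ^ (-(3 / 2) : ℝ)) (Ioi u) :=
    integrableOn_Ioi_rpow_of_lt (by norm_num) hu
  refine Integrable.mono' (Integrable.mul_prod (integrableOn_abs_log_mul_rpow hu) hi) ?_ ?_
  · have h1 : Measurable fun z : ℝ × ℝ => trapezoidWeight (z.2 - u) :=
      measurable_trapezoidWeight.comp (measurable_snd.sub_const u)
    exact ((h1.div ((measurable_fst.add measurable_snd).pow_const 3)).mul
      (Real.measurable_log.comp measurable_fst)).aestronglyMeasurable
  · rw [Measure.prod_restrict]
    refine ae_restrict_of_forall_mem (measurableSet_Ioi.prod measurableSet_Ioi) ?_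
    rintro ⟨t, y⟩ ⟨ht, hy⟩
    have ht : 0 < t := ht
    have hy : u < y := hy
    have h := one_div_add_pow_three_le hu ht.le hy.le
    have hty : 0 < t + y := by linarith
    have h0 : 0 ≤ 1 / (t + y) ^ 3 := by positivity
    have hw0 := trapezoidWeight_nonneg (y - u)
    have hw1 := trapezoidWeight_le_one (y - u)
    simp only [Function.uncurry_apply_pair]
    rw [div_eq_mul_one_div, norm_mul, norm_mul, Real.norm_of_nonneg h0, Real.norm_of_nonneg hw0,
      Real.norm_eq_abs]
    calc trapezoidWeight (y - u) * (1 / (t + y) ^ 3) * |Real.log t|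
        ≤ 1 * ((t + u) ^ (-(3 / 2) : ℝ) * y ^ (-(3 / 2) : ℝ)) * |Real.log t| := by gcongr
      _ = _ := by ring

theorem realDigamma_integrand_eq {u t : ℝ} (hu : 0 < u) (ht : 0 < t) :
    (realDigamma (t + u) - Real.log (t + u) + 1 / (2 * (t + u))) * Real.log t =
      -∫ y in Ioi u, trapezoidWeight (y - u) / (t + y) ^ 3 * Real.log t := by
  rw [realDigamma_sub_log_add hu ht.le, integral_mul_const, neg_mul]

/-- Fubini integrability of the kernel passes to its inner integral, so no separate estimate of ψ is
needed. -/
theorem integrableOn_realDigamma_mul_log {u : ℝ} (hu : 0 < u) :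
    IntegrableOn (fun t : ℝ =>
      (realDigamma (t + u) - Real.log (t + u) + 1 / (2 * (t + u))) * Real.log t) (Ioi 0) := by
  refine IntegrableOn.congr_fun (integrable_weight_kernel hu).integral_prod_left.neg
    (fun t ht => ?_) measurableSet_Ioi
  rw [realDigamma_integrand_eq hu ht]
  rfl

theorem integral_realDigamma_mul_log {u : ℝ} (hu : 0 < u) :
    2 * ∫ t in Ioi (0 : ℝ),
      (realDigamma (t + u) - Real.log (t + u) + 1 / (2 * (t + u))) * Real.log t =
      ∫ y in Ioi u, trapezoidWeight (y - u) * ((1 - Real.log y) / y ^ 2) := by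
  rw [setIntegral_congr_fun measurableSet_Ioi fun t ht => realDigamma_integrand_eq hu ht,
    integral_neg, integral_integral_swap (integrable_weight_kernel hu), ← integral_neg,
    ← integral_const_mul]
  refine setIntegral_congr_fun measurableSet_Ioi fun y hy => ?_
  have hy0 : 0 < y := hu.trans hy
  have h : ∫ t in Ioi (0 : ℝ), trapezoidWeight (y - u) / (t + y) ^ 3 * Real.log t =
      trapezoidWeight (y - u) * ((Real.log y - 1) / (2 * y ^ 2)) := by
    rw [← integral_log_div_pow_three hy0, ← integral_const_mul]
    refine integral_congr_ae (Eventually.of_forall fun t => ?_)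
    ring
  simp only [h]
  field_simp
  ring

/-! ### Comparison of the two integrals at u = 1 -/

/-- The term 4(√t log √t)² is t log² t for t > 0, written so that continuity at 0 follows from that
of x log x. -/
theorem hasDerivAt_log_gap_antideriv {t : ℝ} (ht : 0 < t) :
    HasDerivAt (fun t => t * Real.log t * Real.log (1 + t)
        - 4 * (√t * Real.log √t) ^ 2 - (1 + t) * Real.log (1 + t) + t * Real.log t)
      ((Real.log (1 + t) - Real.log t - 1 / (1 + t)) * Real.log t) t := by
  have h1t : 0 < 1 + t := by linarith
  have hlog := Real.hasDerivAt_log ht.ne'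
  have h0 : HasDerivAt (fun t : ℝ => 1 + t) 1 t := (hasDerivAt_id t).const_add 1
  have hlog1 := h0.log h1t.ne'
  have hm := (hasDerivAt_id t).mul hlog
  have hsq := (hasDerivAt_id t).mul (hlog.pow 2)
  have h := (((hm.mul hlog1).sub hsq).sub (h0.mul hlog1)).add hm
  refine (h.congr_of_eventuallyEq ?_).congr_deriv ?_
  · filter_upwards [lt_mem_nhds ht] with x hx
    simp only [Pi.add_apply, Pi.sub_apply, Pi.mul_apply, Pi.pow_apply, id]
    rw [mul_pow, Real.sq_sqrt hx.le, Real.log_sqrt hx.le]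
    ring
  · simp only [id, Pi.mul_apply, Pi.pow_apply]
    field_simp
    ring

theorem one_div_one_add_le_log_gap {t : ℝ} (ht : 0 < t) :
    1 / (1 + t) ≤ Real.log (1 + t) - Real.log t := by
  have h := Real.log_le_sub_one_of_pos (show 0 < t / (1 + t) by positivity)
  rw [Real.log_div ht.ne' (by positivity)] at h
  have e : t / (1 + t) - 1 = -(1 / (1 + t)) := by field_simp; ring
  linarith

theorem log_gap_le_one_div {t : ℝ} (ht : 0 < t) :
    Real.log (1 + t) - Real.log t ≤ 1 / t := by
  have h := Real.log_le_sub_one_of_pos (show 0 < (1 + t) / t by positivity)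
  rw [Real.log_div (by positivity) ht.ne'] at h
  have e : (1 + t) / t - 1 = 1 / t := by field_simp; ring
  linarith

theorem tendsto_log_gap_antideriv :
    Tendsto (fun t => t * Real.log t * Real.log (1 + t)
        - 4 * (√t * Real.log √t) ^ 2 - (1 + t) * Real.log (1 + t) + t * Real.log t)
      atTop (𝓝 (-1)) := by
  -- With δ = 1 - t(log(1+t) - log t), the antiderivative equals δ - δ log t + (log t - log(1+t)) -
  -- 1. The bound 0 ≤ δ ≤ 1/t sends every term but the last to 0.
  have hb : ∀ t : ℝ, 1 ≤ t → 0 ≤ 1 - t * (Real.log (1 + t) - Real.log t) ∧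
      1 - t * (Real.log (1 + t) - Real.log t) ≤ 1 / t := by
    intro t ht
    have ht0 : 0 < t := by linarith
    have h1 := mul_le_mul_of_nonneg_left (log_gap_le_one_div ht0) ht0.le
    have h2 := mul_le_mul_of_nonneg_left (one_div_one_add_le_log_gap ht0) ht0.le
    have e1 : t * (1 / t) = 1 := by field_simp
    have e2 : t * (1 / (1 + t)) = 1 - 1 / (1 + t) := by field_simp; ring
    have e3 : 1 / (1 + t) ≤ 1 / t := one_div_le_one_div_of_le ht0 (by linarith)
    constructor <;> linarith
  have h1 : Tendsto (fun t => 1 - t * (Real.log (1 + t) - Real.log t)) atTop (𝓝 0) := by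
    refine squeeze_zero' (g := fun t : ℝ => 1 / t) ?_ ?_
      (tendsto_const_nhds.div_atTop tendsto_id)
    · filter_upwards [eventually_ge_atTop 1] with t ht using (hb t ht).1
    · filter_upwards [eventually_ge_atTop 1] with t ht using (hb t ht).2
  have h2 : Tendsto (fun t => Real.log t * (1 - t * (Real.log (1 + t) - Real.log t)))
      atTop (𝓝 0) := by
    refine squeeze_zero' (g := fun t : ℝ => Real.log t / t) ?_ ?_ tendsto_log_div_self
    · filter_upwards [eventually_ge_atTop 1] with t ht
      exact mul_nonneg (Real.log_nonneg ht) (hb t ht).1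
    · filter_upwards [eventually_ge_atTop 1] with t ht
      rw [div_eq_mul_one_div]
      exact mul_le_mul_of_nonneg_left (hb t ht).2 (Real.log_nonneg ht)
  have h3 := ((h1.sub h2).add (tendsto_log_sub_log_add 1)).sub_const 1
  rw [sub_zero, add_zero, zero_sub] at h3
  refine h3.congr' ?_
  filter_upwards [eventually_gt_atTop 0] with t ht
  rw [mul_pow, Real.sq_sqrt ht.le, Real.log_sqrt ht.le, add_comm t 1]
  ring

theorem continuous_log_gap_antideriv :
    ContinuousOn (fun t => t * Real.log t * Real.log (1 + t)
        - 4 * (√t * Real.log √t) ^ 2 - (1 + t) * Real.log (1 + t) + t * Real.log t) (Ici 0) := by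
  have h1 : ContinuousOn (fun t : ℝ => Real.log (1 + t)) (Ici 0) :=
    ContinuousOn.log (by fun_prop) fun t (ht : 0 ≤ t) => by positivity
  have h2 := Real.continuous_mul_log.continuousOn (s := Ici (0 : ℝ))
  have h3 := ((Real.continuous_mul_log.comp Real.continuous_sqrt).pow 2).const_mul (4 : ℝ)
  have h4 : ContinuousOn (fun t : ℝ => 1 + t) (Ici 0) := by fun_prop
  exact (((h2.mul h1).sub h3.continuousOn).sub (h4.mul h1)).add h2

/-- The gap factor is nonnegative, so the integrand has the sign of log t on each side of 1. There,
integrability follows from the antiderivative being continuous at 0 and having a limit at infinity.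
-/
theorem integrableOn_log_gap_mul_log :
    IntegrableOn (fun t => (Real.log (1 + t) - Real.log t - 1 / (1 + t)) * Real.log t)
      (Ioi 0) := by
  rw [← Ioc_union_Ioi_eq_Ioi zero_le_one]
  refine IntegrableOn.union ?_ ?_
  · have h := intervalIntegral.integrableOn_deriv_of_nonneg (a := 0) (b := 1)
      (continuous_log_gap_antideriv.mono Icc_subset_Ici_self).neg
      (fun t ht => (hasDerivAt_log_gap_antideriv ht.1).neg) (fun t ht => ?_)
    · simpa using h.neg
    · have h1 := one_div_one_add_le_log_gap ht.1
      have h2 := Real.log_nonpos ht.1.le ht.2.le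
      nlinarith
  · refine integrableOn_Ioi_deriv_of_nonneg'
      (fun t (ht : 1 ≤ t) => hasDerivAt_log_gap_antideriv (by linarith))
      (fun t (ht : 1 < t) => ?_) tendsto_log_gap_antideriv
    have h1 := one_div_one_add_le_log_gap (show 0 < t by linarith)
    exact mul_nonneg (by linarith) (Real.log_pos ht).le

theorem integral_log_gap_mul_log :
    ∫ t in Ioi (0 : ℝ), (Real.log (1 + t) - Real.log t - 1 / (1 + t)) * Real.log t = -1 := by
  rw [integral_Ioi_of_hasDerivAt_of_tendsto
    (continuous_log_gap_antideriv.continuousWithinAt self_mem_Ici)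
    (fun t ht => hasDerivAt_log_gap_antideriv ht) integrableOn_log_gap_mul_log
    tendsto_log_gap_antideriv]
  simp

theorem realDigamma_one_integrand_eq (t : ℝ) (ht : 0 < t) :
    (realDigamma (1 + t) - Real.log t - 1 / (2 * (1 + t))) * Real.log t =
      (realDigamma (t + 1) - Real.log (t + 1) + 1 / (2 * (t + 1))) * Real.log t +
      (Real.log (1 + t) - Real.log t - 1 / (1 + t)) * Real.log t := by
  rw [add_comm t 1]
  field_simp
  ring

/-- Here ⌈1⌉ - 1 = 0, so no terms are removed, and the parameter 1 is 0 on the circle. -/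
theorem hurwitzZetaPos_one : hurwitzZetaPos 1 = riemannZeta := by
  have h1 : ((1 : ℝ) : UnitAddCircle) = 0 := AddCircle.coe_period 1
  funext s
  simp [hurwitzZetaPos, h1, ← HurwitzZeta.hurwitzZeta_zero]

theorem mainTheorem8 :
    -- the formula for `ζ''(0, u)`, `u > 0`, with a convergent integral
    (∀ u : ℝ, 0 < u →
      MeasureTheory.IntegrableOn
        (fun t : ℝ => (realDigamma (t + u) - Real.log (t + u) + 1 / (2 * (t + u))) * Real.log t)
        (Set.Ioi 0) ∧
      iteratedDeriv 2 (fun s : ℂ => hurwitzZetaPos u s) 0 =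
        (((1 / 2 - u) * Real.log u ^ 2 + 2 * u * Real.log u - 2 * u +
          2 * ∫ t in Set.Ioi (0 : ℝ),
            (realDigamma (t + u) - Real.log (t + u) + 1 / (2 * (t + u))) * Real.log t : ℝ) : ℂ)) ∧
    -- the case `u = 1`
    iteratedDeriv 2 riemannZeta 0 =
      ((-2 + 2 * ∫ t in Set.Ioi (0 : ℝ),
        (realDigamma (t + 1) - Real.log (t + 1) + 1 / (2 * (t + 1))) * Real.log t : ℝ) : ℂ) ∧
    -- its agreement with the other integral formula for `ζ''(0)`
    MeasureTheory.IntegrableOn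
      (fun t : ℝ => (realDigamma (1 + t) - Real.log t - 1 / (2 * (1 + t))) * Real.log t)
      (Set.Ioi 0) ∧
    -2 + 2 * (∫ t in Set.Ioi (0 : ℝ),
        (realDigamma (t + 1) - Real.log (t + 1) + 1 / (2 * (t + 1))) * Real.log t) =
      2 * (∫ t in Set.Ioi (0 : ℝ),
        (realDigamma (1 + t) - Real.log t - 1 / (2 * (1 + t))) * Real.log t) ∧
    iteratedDeriv 2 riemannZeta 0 =
      ((2 * ∫ t in Set.Ioi (0 : ℝ),
        (realDigamma (1 + t) - Real.log t - 1 / (2 * (1 + t))) * Real.log t : ℝ) : ℂ) := by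
  have key : ∀ u : ℝ, 0 < u → iteratedDeriv 2 (hurwitzZetaPos u) 0 =
      (((1 / 2 - u) * Real.log u ^ 2 + 2 * u * Real.log u - 2 * u +
        2 * ∫ t in Set.Ioi (0 : ℝ),
          (realDigamma (t + u) - Real.log (t + u) + 1 / (2 * (t + u))) * Real.log t : ℝ) : ℂ) := by
    intro u hu
    rw [integral_realDigamma_mul_log hu]
    exact iteratedDeriv_two_hurwitzZetaPos_zero hu
  have hzeta : iteratedDeriv 2 riemannZeta 0 = ((-2 + 2 * ∫ t in Set.Ioi (0 : ℝ),
      (realDigamma (t + 1) - Real.log (t + 1) + 1 / (2 * (t + 1))) * Real.log t : ℝ) : ℂ) := by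
    rw [← hurwitzZetaPos_one, key 1 one_pos, Real.log_one]
    congr 1
    ring
  have hagree : -2 + 2 * (∫ t in Set.Ioi (0 : ℝ),
      (realDigamma (t + 1) - Real.log (t + 1) + 1 / (2 * (t + 1))) * Real.log t) =
      2 * (∫ t in Set.Ioi (0 : ℝ),
        (realDigamma (1 + t) - Real.log t - 1 / (2 * (1 + t))) * Real.log t) := by
    rw [setIntegral_congr_fun measurableSet_Ioi realDigamma_one_integrand_eq,
      integral_add (integrableOn_realDigamma_mul_log one_pos) integrableOn_log_gap_mul_log,
      integral_log_gap_mul_log]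
    ring
  refine ⟨fun u hu => ⟨integrableOn_realDigamma_mul_log hu, key u hu⟩, hzeta, ?_, hagree, ?_⟩
  · exact IntegrableOn.congr_fun
      ((integrableOn_realDigamma_mul_log one_pos).add integrableOn_log_gap_mul_log)
      (fun t ht => (realDigamma_one_integrand_eq t ht).symm) measurableSet_Ioi
  · rw [← hagree]
    exact hzeta
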